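/- Let $n\ge 1$ and $k\ge 1$, put $s=n+k$, and write $\pi_\parallel:\mathbb R^s\to\mathbb R^n$ and $\pi_\perp:\mathbb R^s\to\mathbb R^{k}$ for the projections to the first $n$ and to the last $k=s-n$ coordinates. A cut-and-project scheme $(\mathcal L\subset\mathbb R^s,\mathbb R^n)$ is given by a lattice $\mathcal L\subset\mathbb R^s$ of full rank $s$, the dimension of the lattice. It is called generic if $\pi_\parallel$ and $\pi_\perp$ are both injective on $\mathcal L$ and $\pi_\perp(\mathcal L)$ is dense in $\mathbb R^{s-n}$. Let $L\in\mathbb R^{s\times s}$ be a matrix whose columns form a $\mathbb Z$-basis of $\mathcal L$. A matrix $A\in\mathbb R^{n\times n}$ is called a self-similarity of the scheme if $A\pi_\parallel(\mathcal L)\subset\pi_\parallel(\mathcal L)$ and there exist matrices $C\in\mathbb Z^{s\times s}$ and $B\in\mathbb R^{(s-n)\times(s-n)}$ with $\begin{pmatrix}A&O\\O&B\end{pmatrix}L=LC$; this does not depend on the choice of $L$. **Theorem.** Let $n\geq 1$ and let $A\in\mathbb R^{n\times n}$ be diagonalizable over $\mathbb C$. Suppose that all eigenvalues $\lambda\in\sigma(A)\subset\mathbb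 C$ are algebraic integers with the same minimal polynomial $f\in\mathbb Q[X]$ over $\mathbb Q$, and let $d=\deg f$. For $\beta\in\mathbb C$ let $m_A(\beta)$ be the algebraic multiplicity of $\beta$ as an eigenvalue of $A$, with $m_A(\beta)=0$ if $\beta\notin\sigma(A)$. Put $$M=\max\{m_A(\beta):\beta\in\mathbb C,\ f(\beta)=0\},\qquad m=\min\{m_A(\beta):\beta\in\mathbb C,\ f(\beta)=0\}.$$ Then there is a generic cut-and-project scheme $(\mathcal L\subset\mathbb R^s,\mathbb R^n)$ with self-similarity $A$, and the smallest dimension $s$ of the lattice of such a scheme is $$s=\begin{cases}Md&\text{if } m<M,\\ (M+1)d&\text{otherwise.}\end{cases}$$ -/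

import Mathlib

/-- A cut-and-project scheme `(𝓛 ⊂ ℝˢ, ℝⁿ)` with `s = n + k`: a full-rank lattice `𝓛` in
`ℝˢ = ℝⁿ × ℝᵏ`, where `n ≥ 1` is the dimension of the physical space and `k ≥ 1` the dimension of
the internal space. The coordinates of `ℝˢ` are indexed by `Fin n ⊕ Fin k`, the physical ones
first. -/
structure CutAndProjectScheme (n k : ℕ) where
  one_le_physical : 1 ≤ n
  one_le_internal : 1 ≤ k
  lattice : Submodule ℤ (Fin n ⊕ Fin k → ℝ)
  discrete : DiscreteTopology lattice
  isZLattice : IsZLattice ℝ lattice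

namespace CutAndProjectScheme

/-- The projection `π_∥` onto the physical space: the first `n` coordinates. -/
def physProj (n k : ℕ) : (Fin n ⊕ Fin k → ℝ) →ₗ[ℝ] (Fin n → ℝ) :=
  LinearMap.funLeft ℝ ℝ Sum.inl

/-- The projection `π_⊥` onto the internal space: the last `k` coordinates. -/
def intProj (n k : ℕ) : (Fin n ⊕ Fin k → ℝ) →ₗ[ℝ] (Fin k → ℝ) :=
  LinearMap.funLeft ℝ ℝ Sum.inr

variable {n k : ℕ} (Λ : CutAndProjectScheme n k)

/-- `π_∥` is injective on the lattice. -/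
def IsNonDegenerate : Prop :=
  Set.InjOn (physProj n k) (Λ.lattice : Set (Fin n ⊕ Fin k → ℝ))

/-- `π_⊥` is injective on the lattice. -/
def IsAperiodic : Prop :=
  Set.InjOn (intProj n k) (Λ.lattice : Set (Fin n ⊕ Fin k → ℝ))

/-- The image of the lattice under `π_⊥` is dense in the internal space. -/
def IsIrreducible : Prop :=
  Dense (intProj n k '' (Λ.lattice : Set (Fin n ⊕ Fin k → ℝ)))

/-- A scheme is generic if it is non-degenerate, aperiodic and irreducible. -/
structure IsGeneric : Prop where
  nonDegenerate : Λ.IsNonDegenerate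
  aperiodic : Λ.IsAperiodic
  irreducible : Λ.IsIrreducible

/-- `L` is a matrix associated to the lattice: it is non-singular and its columns generate the
lattice over `ℤ`. -/
def IsAssociatedMatrix (L : Matrix (Fin n ⊕ Fin k) (Fin n ⊕ Fin k) ℝ) : Prop :=
  IsUnit L.det ∧ Λ.lattice = Submodule.span ℤ (Set.range L.col)

/-- `A` is a self-similarity of the scheme: `A` maps `π_∥(𝓛)` into itself and, for a matrix `L`
associated to the lattice, there are an integer matrix `C` and a real matrix `B` such that
`diag(A, B) L = L C`. (The condition does not depend on the choice of `L`.) -/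
def IsSelfSimilarity (A : Matrix (Fin n) (Fin n) ℝ) : Prop :=
  Set.MapsTo A.mulVec (physProj n k '' (Λ.lattice : Set (Fin n ⊕ Fin k → ℝ)))
    (physProj n k '' (Λ.lattice : Set (Fin n ⊕ Fin k → ℝ))) ∧
  ∃ L : Matrix (Fin n ⊕ Fin k) (Fin n ⊕ Fin k) ℝ, Λ.IsAssociatedMatrix L ∧
    ∃ (C : Matrix (Fin n ⊕ Fin k) (Fin n ⊕ Fin k) ℤ) (B : Matrix (Fin k) (Fin k) ℝ),
      Matrix.fromBlocks A 0 0 B * L = L * C.map (Int.cast : ℤ → ℝ)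

end CutAndProjectScheme

/-- The complexification of a real square matrix. -/
noncomputable def Matrix.toComplex {n : ℕ} (A : Matrix (Fin n) (Fin n) ℝ) :
    Matrix (Fin n) (Fin n) ℂ :=
  A.map (algebraMap ℝ ℂ)

/-- The real matrix `A` is diagonalizable over `ℂ`: `P⁻¹ A P` is diagonal for some non-singular
complex matrix `P`. -/
def Matrix.IsDiagonalizableOverComplex {n : ℕ} (A : Matrix (Fin n) (Fin n) ℝ) : Prop :=
  ∃ (P : Matrix (Fin n) (Fin n) ℂ) (D : Fin n → ℂ),
    IsUnit P.det ∧ P⁻¹ * A.toComplex * P = Matrix.diagonal D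

/-- The algebraic multiplicity of `β` as an eigenvalue of `A` over `ℂ` (which is `0` if `β` is not
an eigenvalue). -/
noncomputable def Matrix.algMultiplicity {n : ℕ} (A : Matrix (Fin n) (Fin n) ℝ) (β : ℂ) : ℕ :=
  A.toComplex.charpoly.rootMultiplicity β

/-- The set of all `s` for which `A` is a self-similarity of some generic cut-and-project scheme
with a lattice of dimension `s`. -/
def latticeDimensions {n : ℕ} (A : Matrix (Fin n) (Fin n) ℝ) : Set ℕ :=
  {s | ∃ k : ℕ, s = n + k ∧
    ∃ Λ : CutAndProjectScheme n k, Λ.IsGeneric ∧ Λ.IsSelfSimilarity A}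

/-! Lower bound: let `g` be the integral form of `f`. In `diag(A, B) L = L C` the matrix `C` is
integral, and injectivity of the physical projection on the lattice transports `g(A) = 0` to `g(C) =
0`. Hence the characteristic polynomial of `C` is `f ^ a`, the dimension is `a * d`, and, since `f`
has simple roots, no eigenvalue of `A` has multiplicity above `a`; so `a ≥ M`. If `m = M`, then `n =
M * d`, and the nonzero internal space forces `a > M`
(`exists_eq_mul_natDegree_of_mem_latticeDimensions`).

Existence: take `N` copies `1 ⊗ C` of an integer matrix of size `d` killed by `g`, with `N = M` or
`N = M + 1`. Since the multiplicities are at most `N`, `A` is the restriction of `1 ⊗ C` to a real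
invariant subspace, and semisimplicity yields an invariant complement, which carries `B`. This
change of basis need not be generic, but it may be composed with any invertible `T ⊗ 1`, which
commutes with `1 ⊗ C`. Kronecker's criterion turns density into a condition on integer vectors, like
the two injectivity conditions. Each of these countably many conditions is nontrivial because `C`
acts irreducibly over `ℚ`, so some rank one perturbation `T = 1 + u vᵀ` meets them all
(`mem_latticeDimensions_of_intertwiner`). -/

/-! ### Kronecker's density criterion -/

open Filter Topology in
/-- A closed additive subgroup containing nonzero vectors `x i` tending to zero whose directions
converge to `u` contains the line through `u`. -/
theorem AddSubgroup.smul_mem_of_tendsto_direction {E : Type*} [NormedAddCommGroup E]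
    [NormedSpace ℝ E] {H : AddSubgroup E} (hH : IsClosed (H : Set E)) {x : ℕ → E}
    (hx : ∀ i, x i ∈ H) (hlim : Tendsto (fun i => ‖x i‖) atTop (𝓝 0)) {u : E}
    (hu : Tendsto (fun i => ‖x i‖⁻¹ • x i) atTop (𝓝 u)) (t : ℝ) : t • u ∈ H := by
  -- Rounding the coefficient down to an integer keeps the multiple in `H` and costs at most `‖x
  -- i‖`, which tends to zero.
  have h1 : Tendsto (fun i => (⌊t / ‖x i‖⌋ : ℝ) • x i - t • (‖x i‖⁻¹ • x i)) atTop (𝓝 0) := by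
    refine squeeze_zero_norm (fun i => ?_) hlim
    have h2 : (⌊t / ‖x i‖⌋ : ℝ) • x i - t • (‖x i‖⁻¹ • x i)
        = ((⌊t / ‖x i‖⌋ : ℝ) - t / ‖x i‖) • x i := by
      rw [smul_smul, ← sub_smul, div_eq_mul_inv]
    rw [h2, norm_smul]
    refine mul_le_of_le_one_left (norm_nonneg _) ?_
    rw [Real.norm_eq_abs, abs_le]
    constructor
    · linarith [Int.lt_floor_add_one (t / ‖x i‖)]
    · linarith [Int.floor_le (t / ‖x i‖)]
  have h3 : Tendsto (fun i => (⌊t / ‖x i‖⌋ : ℝ) • x i) atTop (𝓝 (t • u)) := by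
    simpa using h1.add (hu.const_smul t)
  refine hH.mem_of_tendsto h3 (Eventually.of_forall fun i => ?_)
  rw [Int.cast_smul_eq_zsmul]
  exact H.zsmul_mem (hx i) _

open Filter Topology in
/-- A closed additive subgroup of a finite-dimensional space that contains no line is discrete
at the origin. -/
theorem AddSubgroup.exists_ball_of_no_line {E : Type*} [NormedAddCommGroup E]
    [NormedSpace ℝ E] [FiniteDimensional ℝ E] {H : AddSubgroup E} (hH : IsClosed (H : Set E))
    (h : ∀ u : E, (∀ t : ℝ, t • u ∈ H) → u = 0) :
    ∃ ε > 0, ∀ x ∈ H, ‖x‖ < ε → x = 0 := by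
  by_contra! hcon
  have hpos : ∀ i : ℕ, (0 : ℝ) < 1 / ((i : ℝ) + 1) := fun i => Nat.one_div_pos_of_nat
  choose x hxH hxlt hx0 using fun i : ℕ => hcon _ (hpos i)
  have hlim : Tendsto (fun i => ‖x i‖) atTop (𝓝 0) :=
    squeeze_zero (fun i => norm_nonneg _) (fun i => (hxlt i).le)
      tendsto_one_div_add_atTop_nhds_zero_nat
  have hsph : ∀ i, ‖x i‖⁻¹ • x i ∈ Metric.sphere (0 : E) 1 := fun i => by
    simp [norm_smul, hx0 i]
  have := FiniteDimensional.proper_real E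
  obtain ⟨u, hu, φ, hφ, hconv⟩ := (isCompact_sphere (0 : E) 1).tendsto_subseq hsph
  have hu0 := h u (AddSubgroup.smul_mem_of_tendsto_direction hH (x := x ∘ φ) (fun i => hxH _)
    (hlim.comp hφ.tendsto_atTop) hconv)
  simp [hu0] at hu

/-- A closed additive subgroup of a nontrivial finite-dimensional space that contains no line
takes integral values under some nonzero linear functional. -/
theorem AddSubgroup.exists_integral_functional_of_no_line {E : Type*} [NormedAddCommGroup E]
    [NormedSpace ℝ E] [FiniteDimensional ℝ E] [Nontrivial E] {H : AddSubgroup E}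
    (hH : IsClosed (H : Set E)) (h : ∀ u : E, (∀ t : ℝ, t • u ∈ H) → u = 0) :
    ∃ ψ : E →ₗ[ℝ] ℝ, ψ ≠ 0 ∧ ∀ x ∈ H, ∃ m : ℤ, ψ x = m := by
  obtain ⟨ε, hε, hball⟩ := AddSubgroup.exists_ball_of_no_line hH h
  by_cases hspan : Submodule.span ℝ (H : Set E) = ⊤
  · let Γ : Submodule ℤ E := AddSubgroup.toIntSubmodule H
    have : DiscreteTopology Γ := by
      refine discreteTopology_of_isOpen_singleton_zero ?_
      rw [Metric.isOpen_singleton_iff]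
      refine ⟨ε, hε, fun y hy => ?_⟩
      rw [dist_zero_right] at hy
      exact Subtype.ext (hball y y.2 hy)
    have : IsZLattice ℝ Γ := ⟨hspan⟩
    have : Module.Free ℤ Γ := ZLattice.module_free ℝ Γ
    let b := Module.Free.chooseBasis ℤ Γ
    let c := b.ofZLatticeBasis ℝ Γ
    obtain ⟨i⟩ := c.index_nonempty
    refine ⟨c.coord i, fun h0 => ?_, fun x hx => ⟨b.repr ⟨x, hx⟩ i, ?_⟩⟩
    · simpa using LinearMap.congr_fun h0 (c i)
    · simpa using b.ofZLatticeBasis_repr_apply ℝ Γ ⟨x, hx⟩ i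
  · obtain ⟨ψ, hψ, hle⟩ := Submodule.exists_le_ker_of_lt_top _ (lt_top_iff_ne_top.2 hspan)
    exact ⟨ψ, hψ, fun x hx => ⟨0, by simpa using hle (Submodule.subset_span hx)⟩⟩


/-- Kronecker's criterion: an additive subgroup of a finite-dimensional real space on which no
nonzero linear functional is integral is dense. -/
theorem AddSubgroup.dense_of_integral_functional_eq_zero {E : Type*} [NormedAddCommGroup E]
    [NormedSpace ℝ E] [FiniteDimensional ℝ E] (H : AddSubgroup E)
    (h : ∀ φ : E →ₗ[ℝ] ℝ, (∀ x ∈ H, ∃ m : ℤ, φ x = m) → φ = 0) : Dense (H : Set E) := by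
  set K := H.topologicalClosure with hK
  have hKc : IsClosed (K : Set E) := H.isClosed_topologicalClosure
  have hHK : H ≤ K := H.le_topologicalClosure
  -- The largest linear subspace inside the closure `K`; the part of `K` in a complement `V'` then
  -- contains no line.
  let V : Submodule ℝ E :=
    { carrier := {v | ∀ t : ℝ, t • v ∈ K}
      add_mem' := fun ha hb t => by rw [smul_add]; exact K.add_mem (ha t) (hb t)
      zero_mem' := fun t => by rw [smul_zero]; exact K.zero_mem
      smul_mem' := fun c v hv t => by rw [smul_smul]; exact hv _ }
  have hVK : ∀ v ∈ V, v ∈ K := fun v hv => by simpa using hv 1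
  obtain ⟨V', hV'⟩ := V.exists_isCompl
  by_cases hbot : V' = ⊥
  · have hV : V = ⊤ := by simpa [hbot] using hV'.sup_eq_top
    intro x
    exact hVK x (hV ▸ Submodule.mem_top)
  have : Nontrivial V' := (Submodule.nontrivial_iff_ne_bot).2 hbot
  exfalso
  obtain ⟨ψ, hψ, hint⟩ := AddSubgroup.exists_integral_functional_of_no_line
    (H := K.comap V'.subtype.toAddMonoidHom) (hKc.preimage continuous_subtype_val)
    (fun u hu => by
      have : (u : E) ∈ V := fun t => hu t
      exact Subtype.ext ((Submodule.disjoint_def.1 hV'.disjoint) _ this u.2))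
  -- Extend `ψ` by zero along `V`. The `V'`-component of `x ∈ H` differs from `x` by an element of
  -- `V ⊆ K`, so it lies in `K`, where `ψ` is integral.
  have hφ := h (ψ ∘ₗ V'.projectionOnto V hV'.symm) (fun x hx => by
    refine hint _ ?_
    have hdec := V.projection_add_projection_eq_self hV' x
    change ((V'.projectionOnto V hV'.symm x : V') : E) ∈ K
    have hv : ((V'.projectionOnto V hV'.symm x : V') : E)
        = x - (V.projectionOnto V' hV' x : V) := by
      rw [eq_sub_iff_add_eq, add_comm]; exact hdec
    rw [hv]
    exact K.sub_mem (hHK hx) (hVK _ (Subtype.coe_prop _)))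
  apply hψ
  ext v
  have := LinearMap.congr_fun hφ (v : E)
  simpa using this

/-! ### From matrices to generic schemes -/

open Matrix in
/-- A non-singular real matrix `L` conjugating `diag(A, B)` to an integer matrix yields a generic
cut-and-project scheme with self-similarity `A`, provided both projections are injective on
integer combinations of the columns and no nonzero functional on the internal space is integral on
them. -/
theorem mem_latticeDimensions_of_matrix {n k : ℕ} (hn : 1 ≤ n) (hk : 1 ≤ k)
    {A : Matrix (Fin n) (Fin n) ℝ} (B : Matrix (Fin k) (Fin k) ℝ)
    (L : Matrix (Fin n ⊕ Fin k) (Fin n ⊕ Fin k) ℝ) (hL : IsUnit L.det)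
    (C : Matrix (Fin n ⊕ Fin k) (Fin n ⊕ Fin k) ℤ)
    (hLC : fromBlocks A 0 0 B * L = L * C.map (Int.cast : ℤ → ℝ))
    (hphys : ∀ z : Fin n ⊕ Fin k → ℤ,
      (∀ i, (L *ᵥ fun j => (z j : ℝ)) (Sum.inl i) = 0) → z = 0)
    (hint : ∀ z : Fin n ⊕ Fin k → ℤ,
      (∀ i, (L *ᵥ fun j => (z j : ℝ)) (Sum.inr i) = 0) → z = 0)
    (hdual : ∀ w : Fin k → ℝ,
      (∀ j, ∃ m : ℤ, ∑ i, w i * L (Sum.inr i) j = m) → w = 0) :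
    n + k ∈ latticeDimensions A := by
  have hLI : LinearIndependent ℝ L.col :=
    Matrix.linearIndependent_cols_of_isUnit ((Matrix.isUnit_iff_isUnit_det _).2 hL)
  let b : Module.Basis (Fin n ⊕ Fin k) ℝ (Fin n ⊕ Fin k → ℝ) :=
    basisOfLinearIndependentOfCardEqFinrank' L.col hLI (by simp)
  have hb : ⇑b = L.col := coe_basisOfLinearIndependentOfCardEqFinrank' _ _ _
  let Λ : Submodule ℤ (Fin n ⊕ Fin k → ℝ) := Submodule.span ℤ (Set.range b)
  have hΛ : ∀ x, x ∈ Λ ↔ ∃ z : Fin n ⊕ Fin k → ℤ, x = L *ᵥ fun j => (z j : ℝ) := fun x => by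
    rw [Submodule.mem_span_range_iff_exists_fun]
    refine exists_congr fun z => ?_
    rw [eq_comm, hb]
    refine Eq.congr_right ?_
    ext i
    simp [Matrix.mulVec, dotProduct, mul_comm]
  refine ⟨k, rfl, ⟨hn, hk, Λ, inferInstance, inferInstance⟩, ⟨?_, ?_, ?_⟩, ?_, L, ⟨hL, ?_⟩,
    C, B, hLC⟩
  · intro x hx y hy hxy
    obtain ⟨z, hz⟩ := (hΛ _).1 (Λ.sub_mem hx hy)
    have h0 := hphys z (fun i => by
      rw [← hz, Pi.sub_apply, sub_eq_zero]; exact congrFun hxy i)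
    rw [← sub_eq_zero, hz, h0]
    ext i; simp [Matrix.mulVec, dotProduct]
  · intro x hx y hy hxy
    obtain ⟨z, hz⟩ := (hΛ _).1 (Λ.sub_mem hx hy)
    have h0 := hint z (fun i => by
      rw [← hz, Pi.sub_apply, sub_eq_zero]; exact congrFun hxy i)
    rw [← sub_eq_zero, hz, h0]
    ext i; simp [Matrix.mulVec, dotProduct]
  -- A functional is the row of its values on the unit vectors, and testing integrality on the
  -- columns of `L` brings it under `hdual`.
  · refine AddSubgroup.dense_of_integral_functional_eq_zero
      (Λ.toAddSubgroup.map (CutAndProjectScheme.intProj n k).toAddMonoidHom) fun φ hφ => ?_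
    have hφs : ∀ x, φ x = ∑ i, φ (Pi.single i 1) * x i := fun x => by
      conv_lhs => rw [← Finset.univ_sum_single x, map_sum]
      refine Finset.sum_congr rfl fun i _ => ?_
      rw [mul_comm, ← smul_eq_mul, ← map_smul]
      congr 1
      ext j
      simp [Pi.single_apply]
    have hw := hdual (fun i => φ (Pi.single i 1)) (fun j => by
      obtain ⟨m, hm⟩ := hφ (CutAndProjectScheme.intProj n k (L.col j))
        ⟨L.col j, Submodule.subset_span ⟨j, congrFun hb j⟩, rfl⟩
      exact ⟨m, by rw [← hm, hφs]; rfl⟩)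
    ext i
    simpa using congrFun hw i
  · rintro _ ⟨x, hx, rfl⟩
    obtain ⟨z, rfl⟩ := (hΛ x).1 hx
    refine ⟨L *ᵥ fun j => ((C *ᵥ z) j : ℝ), (hΛ _).2 ⟨_, rfl⟩, ?_⟩
    have h1 : (fun j => ((C *ᵥ z) j : ℝ)) = C.map (Int.cast : ℤ → ℝ) *ᵥ fun j => (z j : ℝ) := by
      ext j; simp [Matrix.mulVec, dotProduct]
    rw [h1, Matrix.mulVec_mulVec, ← hLC, ← Matrix.mulVec_mulVec]
    generalize (L *ᵥ fun j => (z j : ℝ)) = y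
    ext i
    simp [CutAndProjectScheme.physProj, LinearMap.funLeft, Matrix.mulVec, dotProduct]
  · change Submodule.span ℤ (Set.range b) = _
    rw [hb]

/-! ### Lower bound for the dimension -/

/-- Intertwining relations pass to polynomials. -/
theorem Matrix.aeval_mul_eq_mul_aeval {R S m n : Type*} [CommSemiring R] [CommSemiring S]
    [Algebra R S] [Fintype m] [Fintype n] [DecidableEq m] [DecidableEq n]
    {X : Matrix m m S} {Y : Matrix n n S} {J : Matrix m n S} (h : X * J = J * Y)
    (p : Polynomial R) : Polynomial.aeval X p * J = J * Polynomial.aeval Y p := by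
  induction p using Polynomial.induction_on' with
  | add p q hp hq => rw [map_add, map_add, Matrix.add_mul, Matrix.mul_add, hp, hq]
  | monomial i a =>
    have hpow : ∀ i : ℕ, X ^ i * J = J * Y ^ i := fun i => by
      induction i with
      | zero => simp
      | succ i ih => rw [pow_succ, pow_succ, Matrix.mul_assoc, h, ← Matrix.mul_assoc, ih,
          Matrix.mul_assoc]
    rw [Polynomial.aeval_monomial, Polynomial.aeval_monomial, ← Algebra.smul_def,
      ← Algebra.smul_def, Matrix.smul_mul, Matrix.mul_smul, hpow]

open Matrix in
/-- The integer matrix of a self-similarity `A` of a scheme whose physical projection is injective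
is annihilated by every integer polynomial that annihilates `A`. -/
theorem CutAndProjectScheme.aeval_eq_zero_of_isNonDegenerate {n k : ℕ}
    {Λ : CutAndProjectScheme n k} (hΛ : Λ.IsNonDegenerate) {A : Matrix (Fin n) (Fin n) ℝ}
    {L : Matrix (Fin n ⊕ Fin k) (Fin n ⊕ Fin k) ℝ} (hL : Λ.IsAssociatedMatrix L)
    {C : Matrix (Fin n ⊕ Fin k) (Fin n ⊕ Fin k) ℤ} {B : Matrix (Fin k) (Fin k) ℝ}
    (hLC : fromBlocks A 0 0 B * L = L * C.map (Int.cast : ℤ → ℝ)) {g : Polynomial ℤ}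
    (hg : Polynomial.aeval A g = 0) : Polynomial.aeval C g = 0 := by
  set F := Polynomial.aeval C g with hF
  have hFr : Polynomial.aeval (C.map (Int.cast : ℤ → ℝ)) g = F.map (Int.cast : ℤ → ℝ) := by
    have := Polynomial.aeval_algHom_apply (Algebra.ofId ℤ ℝ).mapMatrix C g
    exact this
  have h1 := aeval_mul_eq_mul_aeval hLC g
  rw [hFr] at h1
  let E : Matrix (Fin n) (Fin n ⊕ Fin k) ℝ := fromCols 1 0
  have hE : A * E = E * fromBlocks A 0 0 B := by
    simp only [E]; rw [fromCols_mul_fromBlocks, mul_fromCols]; simp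
  have h2 := aeval_mul_eq_mul_aeval hE g
  rw [hg, Matrix.zero_mul] at h2
  have h3 : E * (L * F.map (Int.cast : ℤ → ℝ)) = 0 := by
    rw [← h1, ← Matrix.mul_assoc, ← h2, Matrix.zero_mul]
  -- The columns of `L * F` are lattice vectors, and by `h3` their physical parts vanish.
  have h4 : L * F.map (Int.cast : ℤ → ℝ) = 0 := by
    ext i j
    have hmem : (L * F.map (Int.cast : ℤ → ℝ)).col j ∈ Λ.lattice := by
      rw [hL.2, Submodule.mem_span_range_iff_exists_fun]
      refine ⟨fun l => F l j, ?_⟩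
      ext i
      simp [Matrix.mul_apply, mul_comm]
    have h0 := hΛ hmem Λ.lattice.zero_mem (by
      ext a
      have := congrFun (congrFun h3 a) j
      rw [Matrix.mul_apply, Fintype.sum_sum_type] at this
      simpa [E, Matrix.one_apply, CutAndProjectScheme.physProj, LinearMap.funLeft] using this)
    exact congrFun h0 i
  have h5 : F.map (Int.cast : ℤ → ℝ) = 0 := by
    have := congrArg (L⁻¹ * ·) h4
    simpa [← Matrix.mul_assoc, Matrix.nonsing_inv_mul L hL.1] using this
  ext i j
  have := congrFun (congrFun h5 i) j
  simpa using this

open Polynomial in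
/-- A monic polynomial over a field all of whose roots in an algebraically closed extension are
roots of the irreducible monic polynomial `f` is a power of `f`. -/
theorem Polynomial.eq_pow_of_aeval_eq_zero {F Ω : Type*} [Field F] [Field Ω] [Algebra F Ω]
    [IsAlgClosed Ω] {f χ : F[X]} (hf : Irreducible f) (hfm : f.Monic) (hχ : χ.Monic)
    (h : ∀ β : Ω, aeval β χ = 0 → aeval β f = 0) : ∃ a, χ = f ^ a := by
  -- With the full power of `f` split off, a root of the cofactor `g` would have `f` as minimal
  -- polynomial, and `f` would divide `g`.
  obtain ⟨a, g, hg, hχg⟩ := WfDvdMonoid.max_power_factor hχ.ne_zero hf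
  have hgm : g.Monic := (hfm.pow a).of_mul_monic_left (hχg ▸ hχ)
  refine ⟨a, ?_⟩
  by_cases hdeg : g.degree = 0
  · rw [hχg, hgm.degree_le_zero_iff_eq_one.1 hdeg.le, mul_one]
  · obtain ⟨β, hβ⟩ := IsAlgClosed.exists_aeval_eq_zero Ω g hdeg
    have hfβ := h β (by rw [hχg, map_mul, hβ, mul_zero])
    exact absurd ((minpoly.eq_of_irreducible_of_monic hf hfβ hfm) ▸ minpoly.dvd F β hβ) hg

/-- If an irreducible integer polynomial annihilates an integer matrix, then the characteristic
polynomial of the matrix is a power of it. -/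
theorem Matrix.charpoly_eq_pow_of_aeval_eq_zero {ι : Type*} [Fintype ι] [DecidableEq ι]
    {C : Matrix ι ι ℤ} {g : Polynomial ℤ} {f : Polynomial ℚ}
    (hgf : g.map (algebraMap ℤ ℚ) = f) (hf : Irreducible f) (hfm : f.Monic)
    (hC : Polynomial.aeval C g = 0) :
    ∃ a, C.charpoly.map (algebraMap ℤ ℚ) = f ^ a := by
  refine Polynomial.eq_pow_of_aeval_eq_zero (Ω := ℂ) hf hfm (C.charpoly_monic.map _) fun β hβ => ?_
  rw [← hgf, Polynomial.aeval_map_algebraMap]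
  rw [Polynomial.aeval_map_algebraMap, Polynomial.aeval_def, ← Polynomial.eval_map,
    ← Matrix.charpoly_map] at hβ
  have hβ' : β ∈ spectrum ℂ (C.map (algebraMap ℤ ℂ)) := by
    rw [Matrix.mem_spectrum_iff_isRoot_charpoly]; exact hβ
  have hC' : Polynomial.aeval (C.map (algebraMap ℤ ℂ)) g = 0 := by
    have := Polynomial.aeval_algHom_apply (Algebra.ofId ℤ ℂ).mapMatrix C g
    rw [hC, map_zero] at this
    exact this
  -- Spectral mapping: `g(β)` is an eigenvalue of `g(C) = 0`.
  have := spectrum.subset_polynomial_aeval (C.map (algebraMap ℤ ℂ)) (g.map (algebraMap ℤ ℂ))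
    ⟨β, hβ', rfl⟩
  rw [Polynomial.aeval_map_algebraMap, hC', Matrix.mem_spectrum_iff_isRoot_charpoly] at this
  rw [Matrix.charpoly_zero, Polynomial.IsRoot.def, Polynomial.eval_pow, Polynomial.eval_X] at this
  simpa [Polynomial.aeval_def, Polynomial.eval_map] using eq_zero_of_pow_eq_zero this

open Matrix in
/-- The dimension of the lattice of a non-degenerate scheme with self-similarity `A` annihilated by
the irreducible integer polynomial `f` is `a * deg f`, where `a` bounds the multiplicities of the
eigenvalues of `A`. -/
theorem exists_eq_mul_natDegree_of_mem_latticeDimensions {n s : ℕ} {A : Matrix (Fin n) (Fin n) ℝ}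
    {g : Polynomial ℤ} {f : Polynomial ℚ}
    (hgf : g.map (algebraMap ℤ ℚ) = f) (hf : Irreducible f) (hfm : f.Monic)
    (hA : Polynomial.aeval A g = 0) (hs : s ∈ latticeDimensions A) :
    ∃ a, s = a * f.natDegree ∧ n < s ∧ ∀ β, A.algMultiplicity β ≤ a := by
  obtain ⟨k, rfl, Λ, hΛ, -, L, hL, C, B, hLC⟩ := hs
  obtain ⟨a, ha⟩ := Matrix.charpoly_eq_pow_of_aeval_eq_zero hgf hf hfm
    (CutAndProjectScheme.aeval_eq_zero_of_isNonDegenerate hΛ.nonDegenerate hL hLC hA)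
  refine ⟨a, ?_, ?_, fun β => ?_⟩
  · have := congrArg Polynomial.natDegree ha
    rw [(C.charpoly_monic).natDegree_map, Matrix.charpoly_natDegree_eq_dim,
      Polynomial.natDegree_pow] at this
    simpa using this
  · have := Λ.one_le_internal
    omega
  · have h1 : (fromBlocks A 0 0 B).charpoly = (C.map (Int.cast : ℤ → ℝ)).charpoly := by
      have hT : fromBlocks A 0 0 B = L * C.map (Int.cast : ℤ → ℝ) * L⁻¹ := by
        rw [← hLC, Matrix.mul_assoc, Matrix.mul_nonsing_inv L hL.1, Matrix.mul_one]
      rw [hT, Matrix.charpoly_mul_comm, ← Matrix.mul_assoc, Matrix.nonsing_inv_mul L hL.1,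
        Matrix.one_mul]
    have h2 : A.charpoly ∣ (C.map (Int.cast : ℤ → ℝ)).charpoly := by
      rw [← h1, Matrix.charpoly_fromBlocks_zero₁₂]
      exact dvd_mul_right _ _
    have h3 : A.toComplex.charpoly ∣ (f ^ a).map (algebraMap ℚ ℂ) := by
      have := Polynomial.map_dvd (algebraMap ℝ ℂ) h2
      rw [← Matrix.charpoly_map] at this
      refine this.trans (dvd_of_eq ?_)
      rw [← ha, Polynomial.map_map]
      have h4 : (C.map (Int.cast : ℤ → ℝ)).charpoly = C.charpoly.map (Int.castRingHom ℝ) :=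
        Matrix.charpoly_map C (Int.castRingHom ℝ)
      rw [h4, Polynomial.map_map]
      congr 1
    have hne : (f ^ a).map (algebraMap ℚ ℂ) ≠ 0 := ((hfm.pow a).map _).ne_zero
    refine (Polynomial.rootMultiplicity_le_rootMultiplicity_of_dvd hne h3 β).trans ?_
    rw [Polynomial.map_pow, ← Polynomial.count_roots, Polynomial.roots_pow, Multiset.count_nsmul]
    -- In characteristic zero `f` is separable, so a root of `f ^ a` has multiplicity at most `a`.
    have := Multiset.nodup_iff_count_le_one.1
      (Polynomial.nodup_roots (hf.separable.map (f := algebraMap ℚ ℂ))) β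
    nlinarith

/-! ### Diagonalization and multiplicities -/

open Matrix in
theorem Matrix.toComplex_mul_eq_mul_diagonal {n : ℕ} {A : Matrix (Fin n) (Fin n) ℝ}
    {P : Matrix (Fin n) (Fin n) ℂ} {D : Fin n → ℂ} (hP : IsUnit P.det)
    (h : P⁻¹ * A.toComplex * P = diagonal D) : A.toComplex * P = P * diagonal D := by
  rw [← h, ← Matrix.mul_assoc, ← Matrix.mul_assoc, mul_nonsing_inv P hP, Matrix.one_mul]

open Matrix in
theorem Matrix.charpoly_toComplex_of_diagonalization {n : ℕ} {A : Matrix (Fin n) (Fin n) ℝ}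
    {P : Matrix (Fin n) (Fin n) ℂ} {D : Fin n → ℂ} (hP : IsUnit P.det)
    (h : P⁻¹ * A.toComplex * P = diagonal D) :
    A.toComplex.charpoly = ∏ i, (Polynomial.X - Polynomial.C (D i)) := by
  rw [← charpoly_diagonal, ← h, Matrix.charpoly_mul_comm, ← Matrix.mul_assoc,
    mul_nonsing_inv P hP, Matrix.one_mul]

open Matrix in
theorem Matrix.mem_spectrum_of_diagonalization {n : ℕ} {A : Matrix (Fin n) (Fin n) ℝ}
    {P : Matrix (Fin n) (Fin n) ℂ} {D : Fin n → ℂ} (hP : IsUnit P.det)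
    (h : P⁻¹ * A.toComplex * P = diagonal D) (i : Fin n) : D i ∈ spectrum ℂ A.toComplex := by
  rw [mem_spectrum_iff_isRoot_charpoly, charpoly_toComplex_of_diagonalization hP h,
    Polynomial.isRoot_prod]
  exact ⟨i, Finset.mem_univ i, by simp⟩

open Matrix in
theorem Matrix.algMultiplicity_of_diagonalization {n : ℕ} {A : Matrix (Fin n) (Fin n) ℝ}
    {P : Matrix (Fin n) (Fin n) ℂ} {D : Fin n → ℂ} (hP : IsUnit P.det)
    (h : P⁻¹ * A.toComplex * P = diagonal D) (β : ℂ) :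
    A.algMultiplicity β = (Finset.univ.filter fun i => D i = β).card := by
  rw [algMultiplicity, charpoly_toComplex_of_diagonalization hP h, ← Polynomial.count_roots]
  have : (∏ i, (Polynomial.X - Polynomial.C (D i))).roots = Finset.univ.val.map D := by
    rw [Finset.prod, ← Polynomial.roots_multiset_prod_X_sub_C (Finset.univ.val.map D),
      Multiset.map_map]
    rfl
  rw [this, Multiset.count_map]
  simp only [eq_comm (a := β)]
  rfl

-- Diagonalizability is essential here: a polynomial with simple roots need not annihilate a
-- nontrivial Jordan block.
open Matrix in
theorem Matrix.aeval_eq_zero_of_diagonalization {n : ℕ} {A : Matrix (Fin n) (Fin n) ℝ}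
    {P : Matrix (Fin n) (Fin n) ℂ} {D : Fin n → ℂ} (hP : IsUnit P.det)
    (h : P⁻¹ * A.toComplex * P = diagonal D) {g : Polynomial ℤ}
    (hg : ∀ i, Polynomial.aeval (D i) g = 0) : Polynomial.aeval A g = 0 := by
  have hD : Polynomial.aeval (diagonal D) g = 0 := by
    have := Polynomial.aeval_algHom_apply
      ((diagonalAlgHom (n := Fin n) (α := ℂ) ℤ)) D g
    rw [diagonalAlgHom_apply] at this
    rw [this]
    have h0 : Polynomial.aeval D g = 0 := by
      ext i
      have := Polynomial.aeval_algHom_apply (Pi.evalAlgHom ℤ (fun _ : Fin n => ℂ) i) D g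
      simpa [hg i] using this.symm
    rw [h0, map_zero]
  have hP' := aeval_mul_eq_mul_aeval (toComplex_mul_eq_mul_diagonal hP h) g
  rw [hD, Matrix.mul_zero] at hP'
  have h0 : Polynomial.aeval A.toComplex g = 0 := by
    have := congrArg (· * P⁻¹) hP'
    simpa [Matrix.mul_assoc, mul_nonsing_inv P hP] using this
  have h1 : Polynomial.aeval A.toComplex g = (Polynomial.aeval A g).toComplex :=
    Polynomial.aeval_algHom_apply ((Algebra.ofId ℝ ℂ).restrictScalars ℤ).mapMatrix A g
  rw [h0] at h1
  ext i j
  have := congrFun (congrFun h1 i) j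
  simpa [toComplex] using this.symm

open Matrix in
/-- The size of a diagonalizable matrix is the sum of the multiplicities over the roots of a
polynomial that vanishes at all eigenvalues. -/
theorem Matrix.sum_algMultiplicity_of_diagonalization {n : ℕ} {A : Matrix (Fin n) (Fin n) ℝ}
    {P : Matrix (Fin n) (Fin n) ℂ} {D : Fin n → ℂ} (hP : IsUnit P.det)
    (h : P⁻¹ * A.toComplex * P = diagonal D) {S : Finset ℂ} (hS : ∀ i, D i ∈ S) :
    ∑ β ∈ S, A.algMultiplicity β = n := by
  have := Finset.card_eq_sum_card_fiberwise (f := D) (s := Finset.univ) (t := S) fun i _ => hS i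
  rw [Finset.card_univ, Fintype.card_fin] at this
  exact (Finset.sum_congr rfl fun β _ => algMultiplicity_of_diagonalization hP h β).trans this.symm

theorem Polynomial.card_toFinset_roots_map_of_irreducible {f : Polynomial ℚ} (hf : Irreducible f) :
    (f.map (algebraMap ℚ ℂ)).roots.toFinset.card = f.natDegree := by
  rw [Multiset.toFinset_card_of_nodup (Polynomial.nodup_roots hf.separable.map),
    ← (IsAlgClosed.splits _).natDegree_eq_card_roots, Polynomial.natDegree_map]

/-! ### Integer matrices acting irreducibly over `ℚ` -/

/-- A monic integer polynomial annihilates some integer matrix of size its degree. -/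
theorem Polynomial.Monic.exists_matrix_aeval_eq_zero {g : Polynomial ℤ} (hg : g.Monic) :
    ∃ C : Matrix (Fin g.natDegree) (Fin g.natDegree) ℤ, Polynomial.aeval C g = 0 := by
  -- The matrix is multiplication by the root on `ℤ[X]/(g)`.
  let pb := AdjoinRoot.powerBasis' hg
  refine ⟨Algebra.leftMulMatrix pb.basis (AdjoinRoot.root g), ?_⟩
  have h := Polynomial.aeval_algHom_apply (Algebra.leftMulMatrix pb.basis) (AdjoinRoot.root g) g
  rw [AdjoinRoot.aeval_eq, AdjoinRoot.mk_self, map_zero] at h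
  exact h

/-- A rational matrix annihilated by an irreducible polynomial of degree its size acts
irreducibly: every nonzero vector is cyclic. -/
theorem Matrix.exists_aeval_mulVec_eq {d : ℕ} {C : Matrix (Fin d) (Fin d) ℚ} {f : Polynomial ℚ}
    (hf : Irreducible f) (hd : f.natDegree = d) (hC : Polynomial.aeval C f = 0)
    {z : Fin d → ℚ} (hz : z ≠ 0) (y : Fin d → ℚ) :
    ∃ p : Polynomial ℚ, (Polynomial.aeval C p).mulVec z = y := by
  -- `T` maps the coefficients of a polynomial `p` of degree below `d` to `p(C) z`. Both sides have
  -- dimension `d`, so injectivity gives surjectivity.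
  let T : (Fin d → ℚ) →ₗ[ℚ] (Fin d → ℚ) :=
    (Matrix.mulVecBilin ℚ ℚ).flip z ∘ₗ (Polynomial.aeval C).toLinearMap ∘ₗ
      (Polynomial.degreeLT ℚ d).subtype ∘ₗ (Polynomial.degreeLTEquiv ℚ d).symm.toLinearMap
  have hT : ∀ x, T x = (Polynomial.aeval C
    ((Polynomial.degreeLTEquiv ℚ d).symm x : Polynomial ℚ)).mulVec z := fun x => rfl
  have hinj : Function.Injective T := by
    rw [injective_iff_map_eq_zero]
    intro x hx
    rw [hT] at hx
    set p := (Polynomial.degreeLTEquiv ℚ d).symm x with hp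
    by_contra hx0
    have hp0 : (p : Polynomial ℚ) ≠ 0 := fun h => hx0 (by
      have : p = 0 := Subtype.ext h
      simpa [hp] using this)
    have hcop : IsCoprime f (p : Polynomial ℚ) := by
      rw [hf.coprime_iff_not_dvd]
      intro hdvd
      have h1 := Polynomial.natDegree_le_of_dvd hdvd hp0
      have h2 := Polynomial.mem_degreeLT.1 p.2
      rw [Polynomial.degree_eq_natDegree hp0] at h2
      have h3 : (p : Polynomial ℚ).natDegree < d := by exact_mod_cast h2
      omega
    obtain ⟨a, b, hab⟩ := hcop
    apply hz
    have h1 := congrArg (fun q => (Polynomial.aeval C q).mulVec z) hab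
    simpa [hC, ← Matrix.mulVec_mulVec, hx] using h1.symm
  obtain ⟨x, hx⟩ := LinearMap.surjective_of_injective hinj y
  exact ⟨_, (hT x).symm.trans hx⟩

/-- A nonzero real linear map whose kernel is invariant under an integer matrix acting irreducibly
over `ℚ` has no nonzero integer vector in its kernel. -/
theorem LinearMap.apply_intCast_ne_zero {d : ℕ} {C : Matrix (Fin d) (Fin d) ℤ}
    {g : Polynomial ℤ} (hg : Irreducible (g.map (algebraMap ℤ ℚ)))
    (hd : (g.map (algebraMap ℤ ℚ)).natDegree = d)
    (hC : Polynomial.aeval C g = 0) {E : Type*} [AddCommGroup E] [Module ℝ E]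
    {P : (Fin d → ℝ) →ₗ[ℝ] E} (hP : P ≠ 0)
    (hinv : ∀ x, P x = 0 → P ((C.map (Int.cast : ℤ → ℝ)).mulVec x) = 0)
    {z : Fin d → ℤ} (hz : z ≠ 0) : P (fun j => (z j : ℝ)) ≠ 0 := by
  intro h0
  apply hP
  have hCQ : Polynomial.aeval (C.map (Int.cast : ℤ → ℚ)) (g.map (algebraMap ℤ ℚ)) = 0 := by
    have := Polynomial.aeval_algHom_apply (Algebra.ofId ℤ ℚ).mapMatrix C g
    rw [hC, map_zero] at this
    rw [Polynomial.aeval_map_algebraMap]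
    exact this
  have hzQ : (fun j => (z j : ℚ)) ≠ 0 := fun h => hz (by
    ext j; simpa using congrFun h j)
  -- Invariance of the kernel puts the whole rational orbit of `z` in it; since `z` is cyclic, that
  -- orbit contains the standard basis.
  have hker : ∀ p : Polynomial ℚ, P ((Polynomial.aeval (C.map (Int.cast : ℤ → ℝ)) p).mulVec
      fun j => (z j : ℝ)) = 0 := fun p => by
    induction p using Polynomial.induction_on' with
    | add p q hp hq => rw [map_add, Matrix.add_mulVec, map_add, hp, hq, add_zero]
    | monomial i a =>
      rw [Polynomial.aeval_monomial, ← Algebra.smul_def, Matrix.smul_mulVec,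
        ← algebraMap_smul ℝ a, map_smul]
      suffices h : P ((C.map (Int.cast : ℤ → ℝ) ^ i).mulVec fun j => (z j : ℝ)) = 0 by
        rw [h, smul_zero]
      induction i with
      | zero => simpa using h0
      | succ i ih => rw [pow_succ', ← Matrix.mulVec_mulVec]; exact hinv _ ih
  refine LinearMap.pi_ext' fun i => LinearMap.ext_ring ?_
  obtain ⟨p, hp⟩ := Matrix.exists_aeval_mulVec_eq hg hd hCQ hzQ (Pi.single i 1)
  have h1 : (Polynomial.aeval (C.map (Int.cast : ℤ → ℝ)) p).mulVec (fun j => (z j : ℝ))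
      = Pi.single i 1 := by
    have h2 : Polynomial.aeval (C.map (Int.cast : ℤ → ℝ)) p
        = (Polynomial.aeval (C.map (Int.cast : ℤ → ℚ)) p).map (algebraMap ℚ ℝ) := by
      have := Polynomial.aeval_algHom_apply (Algebra.ofId ℚ ℝ).mapMatrix
        (C.map (Int.cast : ℤ → ℚ)) p
      refine Eq.trans ?_ this
      congr 2
    have h3 := congrArg (fun v => (algebraMap ℚ ℝ) ∘ v) hp
    ext j
    have h4 := congrFun h3 j
    simp only [Function.comp_apply, RingHom.map_mulVec] at h4
    rw [h2]
    convert h4 using 1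
    · congr 2
    · simp [Pi.single_apply, apply_ite]
  have := hker p
  rw [h1] at this
  simpa using this

/-! ### Generic rank one perturbations -/

/-- Countably many nonzero matrices `c` can be avoided simultaneously by the rank one perturbations
`1 + u vᵀ`, with `u i = t ^ (i + 1)` and `v j = t ^ (N * j)`, and by the inverses of these. -/
theorem exists_pos_forall_perturbation_ne_zero {N : ℕ} {S : Set (Fin N → Fin N → ℝ)}
    (hS : S.Countable) (h0 : 0 ∉ S) : ∃ t : ℝ, 0 < t ∧ ∀ c ∈ S,
      (∑ i, c i i + ∑ i : Fin N, ∑ j : Fin N, t ^ (i.1 + 1) * t ^ (N * j.1) * c i j ≠ 0) ∧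
      ((1 + ∑ l : Fin N, t ^ (l.1 + 1) * t ^ (N * l.1)) * ∑ i, c i i
        - ∑ i : Fin N, ∑ j : Fin N, t ^ (i.1 + 1) * t ^ (N * j.1) * c j i ≠ 0) := by
  let p : ℝ → (Fin N → Fin N → ℝ) → Polynomial ℝ := fun a c => Polynomial.C a +
    ∑ i : Fin N, ∑ j : Fin N, Polynomial.C (c i j) * Polynomial.X ^ (i.1 + N * j.1 + 1)
  -- The exponents `i + N * j + 1` are positive and pairwise distinct (base `N` digits), so no two
  -- coefficients can cancel.
  have hp : ∀ a c, p a c = 0 → a = 0 ∧ c = 0 := fun a c h => by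
    constructor
    · have := congrArg (fun q => Polynomial.coeff q 0) h
      simpa [p, Polynomial.finsetSum_coeff] using this
    · ext i j
      have := congrArg (fun q => Polynomial.coeff q (i.1 + N * j.1 + 1)) h
      have hinj : ∀ i' j' : Fin N, i.1 + N * j.1 = i'.1 + N * j'.1 ↔ j = j' ∧ i = i' :=
        fun i' j' => by
          have := (finProdFinEquiv (m := N) (n := N)).apply_eq_iff_eq (x := (j, i)) (y := (j', i'))
          rw [Fin.ext_iff, Prod.mk.injEq] at this
          simpa [finProdFinEquiv] using this
      simp [p, Polynomial.coeff_X_pow, hinj,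
        ite_and] at this
      simpa using this
  -- Chosen so that `p (tr c) (c' c)` evaluates to the second expression; when the trace vanishes,
  -- `c'` is minus the transpose of `c`.
  let c' : (Fin N → Fin N → ℝ) → Fin N → Fin N → ℝ := fun c i j =>
    (if i = j then ∑ l, c l l else 0) - c j i
  have hfin : ∀ c ∈ S, {t : ℝ | (p (∑ i, c i i) c).eval t = 0 ∨
      (p (∑ i, c i i) (c' c)).eval t = 0}.Finite := fun c hc => by
    have hne : c ≠ 0 := fun h => h0 (h ▸ hc)
    refine Set.Finite.union ?_ ?_
    · exact Polynomial.finite_setOfPred_isRoot fun h => hne (hp _ _ h).2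
    · refine Polynomial.finite_setOfPred_isRoot fun h => hne ?_
      obtain ⟨h1, h2⟩ := hp _ _ h
      ext i j
      simpa [c', h1] using congrFun (congrFun h2 j) i
  have hcount : (⋃ c ∈ S, {t : ℝ | (p (∑ i, c i i) c).eval t = 0 ∨
      (p (∑ i, c i i) (c' c)).eval t = 0}).Countable :=
    hS.biUnion fun c hc => (hfin c hc).countable
  obtain ⟨t, ht, htS⟩ := (hcount.dense_compl ℝ).inter_open_nonempty _ (isOpen_Ioi (a := (0 : ℝ)))
    ⟨1, Set.mem_Ioi.2 one_pos⟩
  refine ⟨t, ht, fun c hc => ?_⟩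
  have hgood : ¬ ((p (∑ i, c i i) c).eval t = 0 ∨ (p (∑ i, c i i) (c' c)).eval t = 0) :=
    fun h => htS (Set.mem_biUnion hc h)
  rw [not_or] at hgood
  have heval : ∀ a c, (p a c).eval t
      = a + ∑ i : Fin N, ∑ j : Fin N, t ^ (i.1 + 1) * t ^ (N * j.1) * c i j := fun a c => by
    simp only [p, Polynomial.eval_add, Polynomial.eval_C, Polynomial.eval_finsetSum,
      Polynomial.eval_mul, Polynomial.eval_pow, Polynomial.eval_X]
    congr 1
    refine Finset.sum_congr rfl fun i _ => Finset.sum_congr rfl fun j _ => ?_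
    ring
  refine ⟨by rw [← heval]; exact hgood.1, ?_⟩
  convert hgood.2 using 1
  rw [heval]
  simp only [c', mul_sub, Finset.sum_sub_distrib, mul_ite, mul_zero, Finset.sum_ite_eq,
    Finset.mem_univ, if_true]
  rw [← Finset.sum_mul]
  ring

open Kronecker Matrix

/-- The coefficients of a row of `P` contracted with an integer vector over the second index are
not all zero if `P` is a nonzero matrix intertwining an irreducible integer matrix. -/
theorem Matrix.exists_contraction_ne_zero {r : Type*} [Fintype r] [DecidableEq r] {N d : ℕ}
    {C : Matrix (Fin d) (Fin d) ℤ}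
    {g : Polynomial ℤ} (hg : Irreducible (g.map (algebraMap ℤ ℚ)))
    (hd : (g.map (algebraMap ℤ ℚ)).natDegree = d)
    (hC : Polynomial.aeval C g = 0) {P : Matrix r (Fin N × Fin d) ℝ} (hP : P ≠ 0)
    {X : Matrix r r ℝ} (hX : X * P = P * ((1 : Matrix (Fin N) (Fin N) ℝ) ⊗ₖ
      C.map (Int.cast : ℤ → ℝ)))
    {z : Fin N × Fin d → ℤ} (hz : z ≠ 0) :
    ∃ ρ, (fun i j => ∑ a, P ρ (i, a) * (z (j, a) : ℝ)) ≠ 0 := by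
  obtain ⟨i, hi⟩ : ∃ i, (of fun ρ a => P ρ (i, a)) ≠ 0 := by
    by_contra! h
    exact hP (by ext ρ ⟨i, a⟩; exact congrFun (congrFun (h i) ρ) a)
  obtain ⟨j, hj⟩ : ∃ j, (fun a => z (j, a)) ≠ 0 := by
    by_contra! h
    exact hz (by ext ⟨j, a⟩; exact congrFun (h j) a)
  -- A nonzero block of `P` still intertwines `C`, so by irreducibility it cannot kill the nonzero
  -- block `z (j, ·)`.
  set Q : Matrix r (Fin d) ℝ := of fun ρ a => P ρ (i, a) with hQ
  have hXQ : X * Q = Q * C.map (Int.cast : ℤ → ℝ) := by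
    ext ρ a
    have := congrFun (congrFun hX ρ) (i, a)
    simp only [mul_apply, Fintype.sum_prod_type, kroneckerMap_apply, one_apply, map_apply,
      ite_mul, one_mul, zero_mul, mul_ite, mul_zero] at this
    rw [Finset.sum_comm] at this
    simpa [mul_apply, hQ] using this
  have hne := LinearMap.apply_intCast_ne_zero hg hd hC (P := Q.mulVecLin)
    (fun h => hi (by
      ext ρ a
      have := congrFun (LinearMap.congr_fun h (Pi.single a 1)) ρ
      simpa using this))
    (fun x hx => by
      rw [mulVecLin_apply] at hx ⊢
      rw [mulVec_mulVec, ← hXQ, ← mulVec_mulVec, hx, mulVec_zero]) hj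
  obtain ⟨ρ, hρ⟩ := Function.ne_iff.1 hne
  exact ⟨ρ, fun h => hρ (congrFun (congrFun h i) j)⟩

/-- Separates the perturbation `M` from the data `P`, `z`, which enter only through the contracted
coefficients that must be avoided. -/
theorem Matrix.mul_kronecker_one_mulVec {r : Type*} {N d : ℕ}
    (P : Matrix r (Fin N × Fin d) ℝ) (M : Matrix (Fin N) (Fin N) ℝ)
    (z : Fin N × Fin d → ℝ) (ρ : r) :
    ((P * (M ⊗ₖ (1 : Matrix (Fin d) (Fin d) ℝ))) *ᵥ z) ρ
      = ∑ i, ∑ j, M i j * ∑ a, P ρ (i, a) * z (j, a) := by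
  rw [← mulVec_mulVec]
  simp only [mulVec, dotProduct, Fintype.sum_prod_type, kroneckerMap_apply,
    one_apply, mul_ite, mul_one, mul_zero, ite_mul, zero_mul, Finset.sum_ite_eq, Finset.mem_univ,
    if_true, Finset.mul_sum]
  refine Finset.sum_congr rfl fun i _ => ?_
  rw [Finset.sum_comm]
  refine Finset.sum_congr rfl fun j _ => Finset.sum_congr rfl fun a _ => ?_
  ring

theorem Polynomial.aeval_matrix_transpose {R ι : Type*} [CommRing R] [Fintype ι] [DecidableEq ι]
    (C : Matrix ι ι R) (g : Polynomial R) : aeval Cᵀ g = (aeval C g)ᵀ := by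
  induction g using Polynomial.induction_on' with
  | add p q hp hq => rw [map_add, map_add, hp, hq, transpose_add]
  | monomial i a =>
    rw [aeval_monomial, aeval_monomial, ← Algebra.smul_def, ← Algebra.smul_def, transpose_smul,
      transpose_pow]

/-- A real change of basis from `N` copies of an irreducible integer matrix to `diag(A, B)` can be
perturbed to one that defines a generic cut-and-project scheme. -/
theorem mem_latticeDimensions_of_intertwiner {n k N d : ℕ} (hn : 1 ≤ n) (hk : 1 ≤ k)
    {A : Matrix (Fin n) (Fin n) ℝ} {B : Matrix (Fin k) (Fin k) ℝ}
    {C : Matrix (Fin d) (Fin d) ℤ}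
    {g : Polynomial ℤ} (hg : Irreducible (g.map (algebraMap ℤ ℚ)))
    (hd : (g.map (algebraMap ℤ ℚ)).natDegree = d) (hC : Polynomial.aeval C g = 0)
    {Φ : Matrix (Fin n ⊕ Fin k) (Fin N × Fin d) ℝ} {Ψ : Matrix (Fin N × Fin d) (Fin n ⊕ Fin k) ℝ}
    (hΦΨ : Φ * Ψ = 1) (hΨΦ : Ψ * Φ = 1)
    (hΦ : fromBlocks A 0 0 B * Φ = Φ * ((1 : Matrix (Fin N) (Fin N) ℝ) ⊗ₖ
      C.map (Int.cast : ℤ → ℝ))) : n + k ∈ latticeDimensions A := by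
  set K : Matrix (Fin N × Fin d) (Fin N × Fin d) ℝ :=
    (1 : Matrix (Fin N) (Fin N) ℝ) ⊗ₖ C.map (Int.cast : ℤ → ℝ) with hK
  let P₁ : Matrix (Fin n) (Fin N × Fin d) ℝ := Φ.submatrix Sum.inl id
  let P₂ : Matrix (Fin k) (Fin N × Fin d) ℝ := Φ.submatrix Sum.inr id
  -- The transposed physical part of the inverse governs density: it intertwines `Cᵀ`, to which
  -- irreducibility applies as well.
  let P₃ : Matrix (Fin n) (Fin N × Fin d) ℝ := (Ψ.submatrix id Sum.inl)ᵀ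
  have h₁ : A * P₁ = P₁ * K := by
    ext i j
    have := congrFun (congrFun hΦ (Sum.inl i)) j
    simpa [mul_apply, Fintype.sum_sum_type, P₁] using this
  have h₂ : B * P₂ = P₂ * K := by
    ext i j
    have := congrFun (congrFun hΦ (Sum.inr i)) j
    simpa [mul_apply, Fintype.sum_sum_type, P₂] using this
  have h₃ : Aᵀ * P₃ = P₃ * ((1 : Matrix (Fin N) (Fin N) ℝ) ⊗ₖ
      Cᵀ.map (Int.cast : ℤ → ℝ)) := by
    have h4 : Ψ * fromBlocks A 0 0 B = K * Ψ := by
      have := congrArg (fun Y => Ψ * Y * Ψ) hΦ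
      simp only [Matrix.mul_assoc, hΦΨ, Matrix.mul_one] at this
      rw [this, ← Matrix.mul_assoc, hΨΦ, Matrix.one_mul]
    have h5 : (1 : Matrix (Fin N) (Fin N) ℝ) ⊗ₖ Cᵀ.map (Int.cast : ℤ → ℝ) = Kᵀ := by
      ext ⟨i, a⟩ ⟨j, b⟩
      simp [hK, one_apply, eq_comm (a := i)]
    rw [h5]
    simp only [P₃]
    rw [← transpose_mul, ← transpose_mul]
    congr 1
    ext i j
    have := congrFun (congrFun h4 i) (Sum.inl j)
    simpa [mul_apply, Fintype.sum_sum_type] using this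
  have hP₁ : P₁ ≠ 0 := fun h => by
    have h4 := congrFun (congrFun hΦΨ (Sum.inl ⟨0, hn⟩)) (Sum.inl ⟨0, hn⟩)
    rw [mul_apply, one_apply_eq] at h4
    have h5 : ∀ j, Φ (Sum.inl ⟨0, hn⟩) j = 0 := fun j => congrFun (congrFun h ⟨0, hn⟩) j
    simp [h5] at h4
  have hP₂ : P₂ ≠ 0 := fun h => by
    have h4 := congrFun (congrFun hΦΨ (Sum.inr ⟨0, hk⟩)) (Sum.inr ⟨0, hk⟩)
    rw [mul_apply, one_apply_eq] at h4
    have h5 : ∀ j, Φ (Sum.inr ⟨0, hk⟩) j = 0 := fun j => congrFun (congrFun h ⟨0, hk⟩) j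
    simp [h5] at h4
  have hP₃ : P₃ ≠ 0 := fun h => by
    have h4 := congrFun (congrFun hΦΨ (Sum.inl ⟨0, hn⟩)) (Sum.inl ⟨0, hn⟩)
    rw [mul_apply, one_apply_eq] at h4
    have h5 : ∀ j, Ψ j (Sum.inl ⟨0, hn⟩) = 0 := fun j => congrFun (congrFun h ⟨0, hn⟩) j
    simp [h5] at h4
  have hCt : Polynomial.aeval Cᵀ g = 0 := by
    rw [Polynomial.aeval_matrix_transpose, hC, transpose_zero]
  let Z := {z : Fin N × Fin d → ℤ // z ≠ 0}
  choose ρ₁ hρ₁ using fun z : Z => exists_contraction_ne_zero hg hd hC hP₁ h₁ z.2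
  choose ρ₂ hρ₂ using fun z : Z => exists_contraction_ne_zero hg hd hC hP₂ h₂ z.2
  choose ρ₃ hρ₃ using fun z : Z => exists_contraction_ne_zero hg hd hCt hP₃ h₃ z.2
  obtain ⟨t, ht, hgood⟩ := exists_pos_forall_perturbation_ne_zero
    (((Set.countable_range fun z : Z => fun i j => ∑ a, P₁ (ρ₁ z) (i, a) * (z.1 (j, a) : ℝ)).union
      (Set.countable_range fun z : Z => fun i j => ∑ a, P₂ (ρ₂ z) (i, a) * (z.1 (j, a) : ℝ))).union
      (Set.countable_range fun z : Z => fun i j => ∑ a, P₃ (ρ₃ z) (i, a) * (z.1 (j, a) : ℝ)))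
    (by rintro ((⟨z, h⟩ | ⟨z, h⟩) | ⟨z, h⟩); exacts [hρ₁ z h, hρ₂ z h, hρ₃ z h])
  let u : Fin N → ℝ := fun i => t ^ (i.1 + 1)
  let v : Fin N → ℝ := fun j => t ^ (N * j.1)
  let s : ℝ := 1 + ∑ l, u l * v l
  have hs : s ≠ 0 := by positivity
  let M : Matrix (Fin N) (Fin N) ℝ := 1 + vecMulVec u v
  -- The Sherman–Morrison inverse of `M`; `s > 0` because `t > 0`.
  let M' : Matrix (Fin N) (Fin N) ℝ := 1 - s⁻¹ • vecMulVec u v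
  have hMM' : M * M' = 1 := by
    have h4 : vecMulVec u v * vecMulVec u v = (s - 1) • vecMulVec u v := by
      rw [vecMulVec_mul_vecMulVec]
      ext i j
      simp only [vecMulVec_apply, s, dotProduct, Matrix.smul_apply, Pi.smul_apply, smul_eq_mul,
        mul_comm (v _), add_sub_cancel_left]
      ring
    simp only [M, M', Matrix.add_mul, Matrix.mul_sub, Matrix.mul_smul, Matrix.one_mul,
      Matrix.mul_one, h4]
    match_scalars
    · rfl
    · field_simp
      ring
  set G := M ⊗ₖ (1 : Matrix (Fin d) (Fin d) ℝ) with hG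
  set G' := M' ⊗ₖ (1 : Matrix (Fin d) (Fin d) ℝ) with hG'
  have hGG' : G * G' = 1 := by
    rw [hG, hG', ← mul_kronecker_mul, hMM', Matrix.one_mul, one_kronecker_one]
  have hGK : G * K = K * G := by
    rw [hG, hK, ← mul_kronecker_mul, ← mul_kronecker_mul]; simp
  have hM : ∀ c : Fin N → Fin N → ℝ, ∑ i, ∑ j, M i j * c i j
      = ∑ i, c i i + ∑ i : Fin N, ∑ j : Fin N, t ^ (i.1 + 1) * t ^ (N * j.1) * c i j :=
    fun c => by
      simp [M, add_mul, one_apply, vecMulVec_apply, Finset.sum_add_distrib, u, v]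
  have hM' : ∀ c : Fin N → Fin N → ℝ, s * ∑ i, ∑ j, M'ᵀ i j * c i j
      = s * ∑ i, c i i - ∑ i : Fin N, ∑ j : Fin N, t ^ (i.1 + 1) * t ^ (N * j.1) * c j i :=
    fun c => by
      simp only [M', sub_mul, one_apply, vecMulVec_apply, Finset.sum_sub_distrib, u, v,
        transpose_apply, Matrix.sub_apply, Matrix.smul_apply, smul_eq_mul, ite_mul, one_mul, zero_mul,
        Finset.sum_ite_eq', Finset.mem_univ, if_true, mul_sub]
      congr 1
      rw [Finset.sum_comm, Finset.mul_sum]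
      refine Finset.sum_congr rfl fun i _ => ?_
      rw [Finset.mul_sum]
      refine Finset.sum_congr rfl fun j _ => ?_
      field_simp
  have c₁ : ∀ z : Fin N × Fin d → ℤ, (P₁ * G) *ᵥ (fun j => (z j : ℝ)) = 0 → z = 0 := by
    intro z hz
    by_contra hz0
    refine (hgood _ (Or.inl (Or.inl ⟨⟨z, hz0⟩, rfl⟩))).1 ?_
    exact (hM fun i j => ∑ a, P₁ (ρ₁ ⟨z, hz0⟩) (i, a) * (z (j, a) : ℝ)).symm.trans
      ((mul_kronecker_one_mulVec P₁ M (fun j => (z j : ℝ)) _).symm.trans (congrFun hz _))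
  have c₂ : ∀ z : Fin N × Fin d → ℤ, (P₂ * G) *ᵥ (fun j => (z j : ℝ)) = 0 → z = 0 := by
    intro z hz
    by_contra hz0
    refine (hgood _ (Or.inl (Or.inr ⟨⟨z, hz0⟩, rfl⟩))).1 ?_
    exact (hM fun i j => ∑ a, P₂ (ρ₂ ⟨z, hz0⟩) (i, a) * (z (j, a) : ℝ)).symm.trans
      ((mul_kronecker_one_mulVec P₂ M (fun j => (z j : ℝ)) _).symm.trans (congrFun hz _))
  have c₃ : ∀ z : Fin N × Fin d → ℤ,
      (P₃ * (M'ᵀ ⊗ₖ (1 : Matrix (Fin d) (Fin d) ℝ))) *ᵥ (fun j => (z j : ℝ)) = 0 → z = 0 := by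
    intro z hz
    by_contra hz0
    refine (hgood _ (Or.inr ⟨⟨z, hz0⟩, rfl⟩)).2 ?_
    refine (hM' fun i j => ∑ a, P₃ (ρ₃ ⟨z, hz0⟩) (i, a) * (z (j, a) : ℝ)).symm.trans ?_
    rw [← mul_kronecker_one_mulVec P₃ M'ᵀ (fun j => (z j : ℝ)), hz, Pi.zero_apply, mul_zero]
  have hcard : Fintype.card (Fin n ⊕ Fin k) = Fintype.card (Fin N × Fin d) :=
    Matrix.square_of_invertible Φ Ψ hΦΨ hΨΦ
  let σ : Fin n ⊕ Fin k ≃ Fin N × Fin d := Fintype.equivOfCardEq hcard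
  have hmv : ∀ z : Fin n ⊕ Fin k → ℤ,
      ((Φ * G).submatrix id σ) *ᵥ (fun j => (z j : ℝ))
        = (Φ * G) *ᵥ fun j => ((z ∘ σ.symm) j : ℝ) := fun z => by
    rw [submatrix_mulVec_equiv]; rfl
  have hzσ : ∀ z : Fin n ⊕ Fin k → ℤ, z ∘ σ.symm = 0 → z = 0 := fun z h => by
    ext i; simpa using congrFun h (σ i)
  refine mem_latticeDimensions_of_matrix hn hk B ((Φ * G).submatrix id σ) ?_
    ((((1 : Matrix (Fin N) (Fin N) ℤ) ⊗ₖ C)).submatrix σ σ) ?_ ?_ ?_ ?_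
  · rw [← isUnit_iff_isUnit_det]
    refine IsUnit.of_mul_eq_one ((G' * Ψ).submatrix σ id) ?_
    rw [submatrix_mul_equiv, Matrix.mul_assoc, ← Matrix.mul_assoc G, hGG', Matrix.one_mul, hΦΨ,
      submatrix_id_id]
  · have h4 : (((1 : Matrix (Fin N) (Fin N) ℤ) ⊗ₖ C).submatrix σ σ).map (Int.cast : ℤ → ℝ)
        = K.submatrix σ σ := by
      ext i j
      simp [hK, one_apply]
    rw [h4, submatrix_mul_equiv, Matrix.mul_assoc, hGK, ← Matrix.mul_assoc, ← hΦ,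
      Matrix.mul_assoc]
    ext i j
    simp [mul_apply]
  · intro z hz
    refine hzσ z (c₁ _ (funext fun i => ?_))
    have := hz i
    rw [hmv] at this
    exact this
  · intro z hz
    refine hzσ z (c₂ _ (funext fun i => ?_))
    have := hz i
    rw [hmv] at this
    exact this
  · intro w hw
    choose m hm using hw
    -- An integral `w` makes `W * Φ * G` an integer vector. Applying the inverse `G' * Ψ` returns
    -- `W`, whose physical part is zero, so `c₃` kills that integer vector and with it `w`.
    let W : Fin n ⊕ Fin k → ℝ := Sum.elim 0 w
    have h4 : W ᵥ* (Φ * G) = fun j => ((m ∘ σ.symm) j : ℝ) := by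
      ext j
      have := hm (σ.symm j)
      simpa [vecMul, dotProduct, Fintype.sum_sum_type, W] using this
    have h5 : (fun j => ((m ∘ σ.symm) j : ℝ)) ᵥ* (G' * Ψ) = W := by
      rw [← h4, vecMul_vecMul, Matrix.mul_assoc, ← Matrix.mul_assoc G, hGG', Matrix.one_mul, hΦΨ,
        vecMul_one]
    have h6 : m ∘ σ.symm = 0 := by
      refine c₃ _ (funext fun i => ?_)
      have h7 : P₃ * (M'ᵀ ⊗ₖ (1 : Matrix (Fin d) (Fin d) ℝ))
          = ((G' * Ψ).submatrix id Sum.inl)ᵀ := by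
        have h8 : M'ᵀ ⊗ₖ (1 : Matrix (Fin d) (Fin d) ℝ) = G'ᵀ := by
          ext ⟨i, a⟩ ⟨j, b⟩
          simp [hG', one_apply, eq_comm (a := a)]
        rw [h8, ← transpose_mul]
        rfl
      rw [h7, mulVec_transpose]
      exact congrFun h5 (Sum.inl i)
    have h7 := h5
    rw [h6] at h7
    ext i
    have := congrFun h7 (Sum.inr i)
    simpa [vecMul, dotProduct, W] using this.symm

/-! ### Embedding `A` into copies of an integer matrix -/

/-- Every root of the irreducible polynomial annihilating an integer matrix of size its degree is an
eigenvalue of the matrix. -/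
theorem Matrix.exists_eigenvector_of_aeval_eq_zero {d : ℕ} {C : Matrix (Fin d) (Fin d) ℤ}
    {g : Polynomial ℤ} (hg : Irreducible (g.map (algebraMap ℤ ℚ))) (hgm : g.Monic)
    (hd : (g.map (algebraMap ℤ ℚ)).natDegree = d) (hC : Polynomial.aeval C g = 0) {β : ℂ}
    (hβ : Polynomial.aeval β g = 0) :
    ∃ v : Fin d → ℂ, v ≠ 0 ∧ C.map (Int.cast : ℤ → ℂ) *ᵥ v = β • v := by
  obtain ⟨a, ha⟩ := charpoly_eq_pow_of_aeval_eq_zero rfl hg (hgm.map _) hC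
  have hdpos : 0 < d := hd ▸ hg.natDegree_pos
  have ha0 : a ≠ 0 := fun h => by
    have := congrArg Polynomial.natDegree ha
    rw [(C.charpoly_monic).natDegree_map, charpoly_natDegree_eq_dim, h] at this
    simp at this
    omega
  have hroot : (C.map (algebraMap ℤ ℂ)).charpoly.IsRoot β := by
    rw [charpoly_map, Polynomial.IsRoot.def, Polynomial.eval_map_algebraMap,
      ← Polynomial.aeval_map_algebraMap ℚ, ha, map_pow, Polynomial.aeval_map_algebraMap, hβ,
      zero_pow ha0]
  rw [Polynomial.IsRoot.def, eval_charpoly] at hroot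
  obtain ⟨v, hv0, hv⟩ := exists_mulVec_eq_zero_iff.2 hroot
  refine ⟨v, hv0, ?_⟩
  rw [sub_mulVec, sub_eq_zero] at hv
  have h1 : scalar (Fin d) β *ᵥ v = β • v := by
    ext i; simp [scalar_apply, mulVec_diagonal]
  rw [← h1, hv]
  rfl

/-- If each value of `D` is attained at most `N` times, the diagonal matrix of values of `D` embeds
into `N` copies of a matrix with these values among its eigenvalues. -/
theorem Matrix.exists_injective_mul_diagonal {n N d : ℕ} {D : Fin n → ℂ}
    (hD : ∀ β, (Finset.univ.filter fun i => D i = β).card ≤ N) {C : Matrix (Fin d) (Fin d) ℂ}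
    (hC : ∀ i, ∃ v : Fin d → ℂ, v ≠ 0 ∧ C *ᵥ v = D i • v) :
    ∃ J : Matrix (Fin N × Fin d) (Fin n) ℂ,
      ((1 : Matrix (Fin N) (Fin N) ℂ) ⊗ₖ C) * J = J * diagonal D ∧
      ∀ x, J *ᵥ x = 0 → x = 0 := by
  choose V hV0 hV using hC
  have hemb : ∀ β, Nonempty ({i // D i = β} ↪ Fin N) := fun β => by
    rw [Function.Embedding.nonempty_iff_card_le, Fintype.card_fin, Fintype.card_subtype]
    exact hD β
  let e := fun β => (hemb β).some
  -- Indices with equal eigenvalue go to different copies, so the eigenvectors placed in one copy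
  -- have distinct eigenvalues and are independent.
  let r : Fin n → Fin N := fun i => e (D i) ⟨i, rfl⟩
  have hr : ∀ i j, r i = r j → D i = D j → i = j := fun i j h h' => by
    have h1 : ∀ (β : ℂ) (hβ : D j = β), e (D j) ⟨j, rfl⟩ = e β ⟨j, hβ⟩ := by
      rintro _ rfl; rfl
    have h2 : e (D i) ⟨i, rfl⟩ = e (D i) ⟨j, h'.symm⟩ := h.trans (h1 _ h'.symm)
    exact congrArg Subtype.val ((e (D i)).injective h2)
  refine ⟨of fun p i => if p.1 = r i then V i p.2 else 0, ?_, fun x hx => ?_⟩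
  · ext ⟨a, b⟩ i
    have h := congrFun (hV i) b
    simp only [mulVec, dotProduct, Pi.smul_apply, smul_eq_mul] at h
    rw [mul_diagonal, mul_apply, Fintype.sum_prod_type, Fintype.sum_eq_single a
      (fun a' ha' => by simp [ha'.symm])]
    by_cases ha : a = r i
    · simpa [ha, mul_comm] using h
    · simp [ha]
  · ext i
    have hli : LinearIndependent ℂ fun j : {j // r j = r i} => V j.1 := by
      refine Module.End.eigenvectors_linearIndependent' (toLin' C) (fun j => D j.1)
        (fun j k hjk => Subtype.ext (hr _ _ (j.2.trans k.2.symm) hjk)) _ fun j => ?_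
      rw [Module.End.hasEigenvector_iff, Module.End.mem_eigenspace_iff]
      exact ⟨by rw [toLin'_apply, hV], hV0 _⟩
    rw [Fintype.linearIndependent_iff] at hli
    refine hli (fun j => x j.1) ?_ ⟨i, rfl⟩
    ext b
    have h := congrFun hx (r i, b)
    simp only [mulVec, dotProduct, of_apply, ite_mul, zero_mul, Pi.zero_apply] at h
    rw [← Finset.sum_filter] at h
    rw [Finset.sum_apply, Pi.zero_apply, ← h]
    have h2 : ∑ j with r i = r j, V j b * x j = ∑ j : {j // r j = r i}, V j.1 b * x j.1 :=
      Finset.sum_subtype _ (by simp [eq_comm]) _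
    rw [h2]
    exact Finset.sum_congr rfl fun j _ => mul_comm _ _

/-- Real matrices intertwined by an injective complex matrix are intertwined by an injective real
one. -/
theorem Matrix.exists_real_intertwiner {n : ℕ} {τ : Type*} [Fintype τ] [DecidableEq τ]
    {A : Matrix (Fin n) (Fin n) ℝ} {K : Matrix τ τ ℝ} {J : Matrix τ (Fin n) ℂ}
    (hJ : K.map (algebraMap ℝ ℂ) * J = J * A.toComplex) (hinj : ∀ x, J *ᵥ x = 0 → x = 0) :
    ∃ J' : Matrix τ (Fin n) ℝ, K * J' = J' * A ∧ ∀ x, J' *ᵥ x = 0 → x = 0 := by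
  let R : Matrix τ (Fin n) ℝ := J.map Complex.re
  let I : Matrix τ (Fin n) ℝ := J.map Complex.im
  have hR : K * R = R * A := by
    ext i j
    have := congrArg Complex.re (congrFun (congrFun hJ i) j)
    simpa [mul_apply, toComplex, R] using this
  have hI : K * I = I * A := by
    ext i j
    have := congrArg Complex.im (congrFun (congrFun hJ i) j)
    simpa [mul_apply, toComplex, I] using this
  obtain ⟨H, hH⟩ : ∃ H : Matrix (Fin n) τ ℂ, H * J = 1 := by
    obtain ⟨h, hh⟩ := (toLin' J).exists_leftInverse_of_injective (LinearMap.ker_eq_bot'.2 hinj)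
    refine ⟨LinearMap.toMatrix' h, ?_⟩
    rw [← LinearMap.toMatrix'_toLin' J, ← LinearMap.toMatrix'_comp, hh, LinearMap.toMatrix'_id]
  let Rc : Matrix (Fin n) (Fin n) ℂ := H * R.map (algebraMap ℝ ℂ)
  let Ic : Matrix (Fin n) (Fin n) ℂ := H * I.map (algebraMap ℝ ℂ)
  -- `p(t)` is the determinant of `H (R + t I)`. At the imaginary unit it is `det (H J) = 1`, so `p`
  -- is nonzero and some real `t` is not a root.
  let p : Polynomial ℂ := (Rc.map Polynomial.C + (Polynomial.X : Polynomial ℂ) •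
    Ic.map Polynomial.C).det
  have hp : ∀ t : ℂ, p.eval t = (Rc + t • Ic).det := fun t => by
    rw [← Polynomial.coe_evalRingHom, RingHom.map_det]
    congr 1
    ext i j
    simp [mul_comm t]
  have hp0 : p ≠ 0 := fun h => by
    have h1 := hp Complex.I
    have h2 : Rc + Complex.I • Ic = 1 := by
      rw [← hH, ← Matrix.mul_smul, ← Matrix.mul_add]
      congr 1
      ext i j
      simp [R, I, mul_comm Complex.I]
    rw [h, h2] at h1
    simp at h1
  obtain ⟨t, ht⟩ : ∃ t : ℝ, p.eval (t : ℂ) ≠ 0 := by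
    by_contra! hcon
    refine hp0 (Polynomial.eq_zero_of_infinite_isRoot p ?_)
    exact (Set.infinite_range_of_injective Complex.ofReal_injective).mono (by
      rintro _ ⟨t, rfl⟩; exact hcon t)
  refine ⟨R + t • I, ?_, fun x hx => ?_⟩
  · rw [Matrix.mul_add, Matrix.add_mul, Matrix.mul_smul, Matrix.smul_mul, hR, hI]
  · rw [hp] at ht
    have h1 : (Rc + (t : ℂ) • Ic) *ᵥ (fun i => (x i : ℂ)) = 0 := by
      have h2 : Rc + (t : ℂ) • Ic = H * (R + t • I).map (algebraMap ℝ ℂ) := by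
        rw [← Matrix.mul_smul, ← Matrix.mul_add]
        congr 1
        ext i j
        simp
      have h3 : (R + t • I).map (algebraMap ℝ ℂ) *ᵥ (fun i => (x i : ℂ)) = 0 := by
        ext i
        have := congrArg (algebraMap ℝ ℂ) (congrFun hx i)
        rw [RingHom.map_mulVec] at this
        simpa [Function.comp_def] using this
      rw [h2, ← mulVec_mulVec, h3, mulVec_zero]
    have h4 := eq_zero_of_mulVec_eq_zero ht h1
    ext i
    simpa using congrFun h4 i

/-- An injective intertwiner into a semisimple matrix extends to a change of basis to a block
diagonal matrix. -/
theorem Matrix.exists_block_intertwiner {n : ℕ} {τ : Type*} [Fintype τ] [DecidableEq τ]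
    {A : Matrix (Fin n) (Fin n) ℝ} {K : Matrix τ τ ℝ} {J : Matrix τ (Fin n) ℝ}
    (hJ : K * J = J * A) (hinj : ∀ x, J *ᵥ x = 0 → x = 0) (hK : Module.End.IsSemisimple K.toLin') :
    ∃ (k : ℕ) (B : Matrix (Fin k) (Fin k) ℝ) (Φ : Matrix (Fin n ⊕ Fin k) τ ℝ)
      (Ψ : Matrix τ (Fin n ⊕ Fin k) ℝ), Φ * Ψ = 1 ∧ Ψ * Φ = 1 ∧
      fromBlocks A 0 0 B * Φ = Φ * K := by
  let U : Submodule ℝ (τ → ℝ) := LinearMap.range J.mulVecLin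
  have hU : U ∈ Module.End.invtSubmodule K.toLin' := by
    rintro _ ⟨x, rfl⟩
    refine ⟨A *ᵥ x, ?_⟩
    simp [hJ]
  -- `B` will be the matrix of `K` on an invariant complement of the image of `J`.
  obtain ⟨V, hV, hUV⟩ := Module.End.isSemisimple_iff.1 hK U hU
  let b := Module.finBasis ℝ V
  let k := Module.finrank ℝ V
  let B : Matrix (Fin k) (Fin k) ℝ := of fun i j => b.repr ⟨K.toLin' (b j), hV (b j).2⟩ i
  let E : Matrix τ (Fin k) ℝ := of fun a j => (b j : τ → ℝ) a
  have hEv : ∀ y, E *ᵥ y = (b.equivFun.symm y : V) := fun y => by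
    rw [b.equivFun_symm_apply]
    ext a
    simp [E, mulVec, dotProduct, mul_comm]
    rfl
  have hE : K * E = E * B := by
    ext a j
    have h1 := congrArg (fun w : V => (w : τ → ℝ) a)
      (b.sum_repr ⟨K.toLin' (b j), hV (b j).2⟩)
    simp only [AddSubmonoidClass.coe_finsetSum, Submodule.coe_smul, Finset.sum_apply,
      Pi.smul_apply, smul_eq_mul, toLin'_apply, mulVec, dotProduct] at h1
    simp only [mul_apply, E, B, of_apply]
    rw [← h1]
    exact Finset.sum_congr rfl fun i _ => mul_comm _ _
  let Ψ : Matrix τ (Fin n ⊕ Fin k) ℝ := fromCols J E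
  have hΨ : K * Ψ = Ψ * fromBlocks A 0 0 B := by
    simp only [Ψ]
    rw [fromCols_mul_fromBlocks, mul_fromCols, hJ, hE]
    simp
  have hΨinj : Function.Injective Ψ.mulVecLin := by
    rw [injective_iff_map_eq_zero]
    intro x hx
    have hsum : J *ᵥ (x ∘ Sum.inl) + E *ᵥ (x ∘ Sum.inr) = 0 := by
      rw [← hx, mulVecLin_apply, fromCols_mulVec]
    have hJE : J *ᵥ (x ∘ Sum.inl) = 0 := by
      refine Submodule.disjoint_def.1 hUV.disjoint _ ⟨_, rfl⟩ ?_
      rw [eq_neg_of_add_eq_zero_left hsum, hEv]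
      exact V.neg_mem (Subtype.coe_prop _)
    have h1 := hinj _ hJE
    rw [hJE, zero_add, hEv] at hsum
    have h2 : x ∘ Sum.inr = 0 := by
      have : b.equivFun.symm (x ∘ Sum.inr) = 0 := Subtype.ext hsum
      exact (LinearEquiv.map_eq_zero_iff _).1 this
    ext (i | i)
    · exact congrFun h1 i
    · exact congrFun h2 i
  have hfin : Module.finrank ℝ (Fin n ⊕ Fin k → ℝ) = Module.finrank ℝ (τ → ℝ) := by
    have h1 : Module.finrank ℝ U = n := by
      rw [LinearMap.finrank_range_of_inj ((injective_iff_map_eq_zero _).2 hinj)]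
      simp
    have h2 := Submodule.finrank_add_eq_of_isCompl hUV
    rw [← h2, h1]
    simp [k]
  let e := LinearEquiv.ofInjectiveOfFinrankEq Ψ.mulVecLin hΨinj hfin
  let Φ : Matrix (Fin n ⊕ Fin k) τ ℝ := LinearMap.toMatrix' e.symm.toLinearMap
  have he : e.toLinearMap = toLin' Ψ := by ext; rfl
  have hΦΨ : Φ * Ψ = 1 := by
    rw [← LinearMap.toMatrix'_toLin' Ψ, ← LinearMap.toMatrix'_comp, ← he]
    simp
  have hΨΦ : Ψ * Φ = 1 := by
    rw [← LinearMap.toMatrix'_toLin' Ψ, ← LinearMap.toMatrix'_comp, ← he]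
    simp
  refine ⟨k, B, Φ, Ψ, hΦΨ, hΨΦ, ?_⟩
  have := congrArg (fun Y => Φ * Y * Φ) hΨ
  simp only [Matrix.mul_assoc, hΨΦ, Matrix.mul_one] at this
  rw [this, ← Matrix.mul_assoc, hΦΨ, Matrix.one_mul]

theorem Matrix.aeval_one_kronecker_eq_zero {N d : ℕ} {C : Matrix (Fin d) (Fin d) ℝ}
    {g : Polynomial ℤ} (hC : Polynomial.aeval C g = 0) :
    Polynomial.aeval ((1 : Matrix (Fin N) (Fin N) ℝ) ⊗ₖ C) g = 0 := by
  ext p ⟨j, b⟩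
  -- The inclusion of the `j`-th copy intertwines `C` with `1 ⊗ C`, so the claim can be read off one
  -- block column at a time.
  let S : Matrix (Fin N × Fin d) (Fin d) ℝ := of fun q a => if q = (j, a) then 1 else 0
  have hS : ((1 : Matrix (Fin N) (Fin N) ℝ) ⊗ₖ C) * S = S * C := by
    ext ⟨i, a⟩ b
    by_cases hij : i = j <;>
      simp [S, mul_apply, hij]
  have h1 := congrFun (congrFun (aeval_mul_eq_mul_aeval hS g) p) b
  rw [hC, Matrix.mul_zero] at h1
  simpa [mul_apply, S] using h1

/-- Over `ℝ` the polynomial `g` may factor, but separability survives the field extension and keeps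
it squarefree. -/
theorem Matrix.isSemisimple_toLin'_of_aeval_eq_zero {τ : Type*} [Fintype τ] [DecidableEq τ]
    {K : Matrix τ τ ℝ} {g : Polynomial ℤ} (hg : Irreducible (g.map (algebraMap ℤ ℚ)))
    (hK : Polynomial.aeval K g = 0) : Module.End.IsSemisimple K.toLin' := by
  have hsep : (g.map (algebraMap ℤ ℝ)).Separable := by
    have := hg.separable.map (f := algebraMap ℚ ℝ)
    rwa [Polynomial.map_map, ← IsScalarTower.algebraMap_eq] at this
  refine Module.End.isSemisimple_of_squarefree_aeval_eq_zero hsep.squarefree ?_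
  have := Polynomial.aeval_algHom_apply (toLinAlgEquiv' (R := ℝ) (n := τ)).toAlgHom K
    (g.map (algebraMap ℤ ℝ))
  rw [Polynomial.aeval_map_algebraMap _ K, hK, map_zero] at this
  exact this

/-- A diagonalizable matrix annihilated by an irreducible monic integer polynomial of degree `d` is
a self-similarity of a generic scheme of dimension `N * d` as soon as `N` bounds the multiplicities
of its eigenvalues and `N * d` exceeds the physical dimension. -/
theorem mul_natDegree_mem_latticeDimensions {n N : ℕ} (hn : 1 ≤ n)
    {A : Matrix (Fin n) (Fin n) ℝ} {P : Matrix (Fin n) (Fin n) ℂ} {D : Fin n → ℂ}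
    (hP : IsUnit P.det) (h : P⁻¹ * A.toComplex * P = diagonal D)
    {g : Polynomial ℤ} (hgm : g.Monic) (hg : Irreducible (g.map (algebraMap ℤ ℚ)))
    (hD : ∀ i, Polynomial.aeval (D i) g = 0) (hN : ∀ β, A.algMultiplicity β ≤ N)
    (hlt : n < N * g.natDegree) : N * g.natDegree ∈ latticeDimensions A := by
  obtain ⟨C, hC⟩ := hgm.exists_matrix_aeval_eq_zero
  have hd : (g.map (algebraMap ℤ ℚ)).natDegree = g.natDegree := hgm.natDegree_map _
  obtain ⟨J₀, hJ₀, hinj₀⟩ := exists_injective_mul_diagonal (N := N) (D := D)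
    (fun β => algMultiplicity_of_diagonalization hP h β ▸ hN β)
    (fun i => exists_eigenvector_of_aeval_eq_zero hg hgm hd hC (hD i))
  set K := (1 : Matrix (Fin N) (Fin N) ℝ) ⊗ₖ C.map (Int.cast : ℤ → ℝ) with hK
  have hKc : K.map (algebraMap ℝ ℂ)
      = (1 : Matrix (Fin N) (Fin N) ℂ) ⊗ₖ C.map (Int.cast : ℤ → ℂ) := by
    ext ⟨i, a⟩ ⟨j, b⟩
    by_cases hij : i = j
    · subst hij; simp [hK]
    · simp [hK, hij]
  have hAP : P⁻¹ * A.toComplex = diagonal D * P⁻¹ := by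
    rw [← h, Matrix.mul_assoc, mul_nonsing_inv P hP, Matrix.mul_one]
  obtain ⟨J, hJ, hinj⟩ := exists_real_intertwiner (A := A) (K := K) (J := J₀ * P⁻¹)
    (by rw [hKc, ← Matrix.mul_assoc, hJ₀, Matrix.mul_assoc, Matrix.mul_assoc, hAP])
    (fun x hx => by
      rw [← mulVec_mulVec] at hx
      have h1 := congrArg (P *ᵥ ·) (hinj₀ _ hx)
      simpa [mul_nonsing_inv P hP] using h1)
  have hCr : Polynomial.aeval (C.map (Int.cast : ℤ → ℝ)) g = 0 := by
    have := Polynomial.aeval_algHom_apply (Algebra.ofId ℤ ℝ).mapMatrix C g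
    rw [hC, map_zero] at this
    exact this
  obtain ⟨k, B, Φ, Ψ, hΦΨ, hΨΦ, hΦ⟩ := exists_block_intertwiner hJ hinj
    (isSemisimple_toLin'_of_aeval_eq_zero hg (aeval_one_kronecker_eq_zero hCr))
  have hcard : n + k = N * g.natDegree := by
    simpa using Matrix.square_of_invertible Φ Ψ hΦΨ hΨΦ
  rw [← hcard]
  exact mem_latticeDimensions_of_intertwiner hn (by omega) hg hd hC hΦΨ hΨΦ hΦ

/-! ### The minimal dimension -/

theorem mainTheorem2 {n : ℕ} (hn : 1 ≤ n) (A : Matrix (Fin n) (Fin n) ℝ)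
    (hA : A.IsDiagonalizableOverComplex) (f : Polynomial ℚ)
    (hf : ∀ lam ∈ spectrum ℂ A.toComplex, IsIntegral ℤ lam ∧ minpoly ℚ lam = f)
    (M m : ℕ)
    (hM : IsGreatest {j : ℕ | ∃ β : ℂ, Polynomial.aeval β f = 0 ∧ j = A.algMultiplicity β} M)
    (hm : IsLeast {j : ℕ | ∃ β : ℂ, Polynomial.aeval β f = 0 ∧ j = A.algMultiplicity β} m) :
    IsLeast (latticeDimensions A)
      (if m < M then M * f.natDegree else (M + 1) * f.natDegree) := by
  obtain ⟨P, D, hP, hPD⟩ := hA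
  have hD := fun i => hf _ (mem_spectrum_of_diagonalization hP hPD i)
  obtain ⟨hint, hmin⟩ := hD ⟨0, hn⟩
  set g := minpoly ℤ (D ⟨0, hn⟩) with hg
  have hgm : g.Monic := minpoly.monic hint
  have hgf : g.map (algebraMap ℤ ℚ) = f := by
    rw [← hmin, hg, minpoly.isIntegrallyClosed_eq_field_fractions' ℚ hint]
  have hfirr : Irreducible f := hmin ▸ minpoly.irreducible hint.tower_top
  have hfm : f.Monic := hgf ▸ hgm.map _
  have hdeg : g.natDegree = f.natDegree := by rw [← hgf, hgm.natDegree_map]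
  have hdpos : 0 < f.natDegree := hfirr.natDegree_pos
  have hDf : ∀ i, Polynomial.aeval (D i) f = 0 := fun i => (hD i).2 ▸ minpoly.aeval ℚ (D i)
  have hDg : ∀ i, Polynomial.aeval (D i) g = 0 := fun i => by
    rw [← Polynomial.aeval_map_algebraMap ℚ, hgf, hDf]
  have hAg : Polynomial.aeval A g = 0 := aeval_eq_zero_of_diagonalization hP hPD hDg
  let S := (f.map (algebraMap ℚ ℂ)).roots.toFinset
  have hS : ∀ β, β ∈ S ↔ Polynomial.aeval β f = 0 := fun β => by
    simp [S, hfirr.ne_zero, Polynomial.IsRoot.def, Polynomial.eval_map_algebraMap]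
  have hScard : S.card = f.natDegree := Polynomial.card_toFinset_roots_map_of_irreducible hfirr
  have hsum := sum_algMultiplicity_of_diagonalization hP hPD (S := S) fun i => (hS _).2 (hDf i)
  have hle : ∀ β, A.algMultiplicity β ≤ M := fun β => by
    by_cases hβ : ∃ i, D i = β
    · obtain ⟨i, rfl⟩ := hβ
      exact hM.2 ⟨_, hDf i, rfl⟩
    · rw [algMultiplicity_of_diagonalization hP hPD, Finset.filter_false_of_mem
        fun i _ hi => hβ ⟨i, hi⟩]
      exact Nat.zero_le _
  -- `n` is the sum of the multiplicities over the `d` distinct roots of `f`, hence lies between `m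
  -- * d` and `M * d`.
  have hge : m * f.natDegree ≤ n := by
    rw [← hsum, ← hScard, mul_comm, ← smul_eq_mul]
    exact Finset.card_nsmul_le_sum _ _ _ fun β hβ => hm.2 ⟨β, (hS β).1 hβ, rfl⟩
  have hnle : n ≤ M * f.natDegree := by
    rw [← hsum, ← hScard, mul_comm, ← smul_eq_mul]
    exact Finset.sum_le_card_nsmul _ _ _ fun β _ => hle β
  obtain ⟨β₀, hβ₀, hMβ⟩ := hM.1
  obtain ⟨β₁, hβ₁, hmβ⟩ := hm.1
  split_ifs with hmM
  · constructor
    · rw [← hdeg]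
      refine mul_natDegree_mem_latticeDimensions hn hP hPD hgm (hgf ▸ hfirr) hDg hle ?_
      rw [hdeg]
      calc n = ∑ β ∈ S, A.algMultiplicity β := hsum.symm
        _ < ∑ _β ∈ S, M :=
          Finset.sum_lt_sum (fun β _ => hle β) ⟨β₁, (hS _).2 hβ₁, hmβ ▸ hmM⟩
        _ = M * f.natDegree := by rw [Finset.sum_const, hScard, smul_eq_mul, mul_comm]
    · intro s hs
      obtain ⟨a, rfl, -, ha⟩ :=
        exists_eq_mul_natDegree_of_mem_latticeDimensions hgf hfirr hfm hAg hs
      exact Nat.mul_le_mul_right _ (hMβ ▸ ha β₀)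
  · constructor
    · rw [← hdeg]
      refine mul_natDegree_mem_latticeDimensions hn hP hPD hgm (hgf ▸ hfirr) hDg
        (fun β => (hle β).trans M.le_succ) ?_
      rw [hdeg]
      nlinarith
    · intro s hs
      obtain ⟨a, rfl, hlt, -⟩ :=
        exists_eq_mul_natDegree_of_mem_latticeDimensions hgf hfirr hfm hAg hs
      -- Here `M ≤ m`, so `M * d ≤ m * d ≤ n < a * d`: the positive internal dimension costs one
      -- further copy.
      refine Nat.mul_le_mul_right _ (Nat.lt_of_mul_lt_mul_right (a := f.natDegree) ?_)
      exact (Nat.mul_le_mul_right _ (not_lt.1 hmM)).trans_lt (hge.trans_lt hlt)
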